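/- Consider $n$-player games in which every player has the action set $\{0,1\}$. Fix $K>0$. A type of player $i$ is a utility function $u_i:\{0,1\}^n\to[0,1]$ that is $K/n$-sensitive: for every $j\neq i$, changing only the action of player $j$ changes $u_i$ by at most $K/n$ (the dependence on player $i$'s own action is unrestricted). A distribution $\pi$ on $\{0,1\}^n$ is an $\eta$-approximate coarse correlated equilibrium of the game $(u_1,\dots,u_n)$ if $\mathbb E_{a\sim\pi}[u_i(a)]\ge \mathbb E_{a\sim\pi}[u_i(b,a_{-i})]-\eta$ for every player $i$ and every fixed action $b\in\{0,1\}$. A mechanism $\mathcal M$ maps each profile $u=(u_1,\dots,u_n)$ of types to a probability distribution over output profiles $r=(r_1,\dots,r_n)\in R_1\times\dots\times R_n$, where $R_1,\dots,R_n$ are arbitrary measurable spaces and $r_i$ is sent to player $i$. Player $i$ then plays the action $f_i(r_i,\omega)\in\{0,1\}$, where the $f_i$ are fixed measurable functions and $\omega$ is drawn by a correlating device, independently of $r$ and from a law that does not depend on $u$. (Two examples: $r_i$ is a suggested action; $r_i$ is a sequence of mixed strategies, and the play in a uniformly random common round is used.) The mechanism computes an $\eta$-approximate coarse correlated equilibrium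 if, for every $u$, the resulting distribution of $(f_1(r_1,\omega),\dots,f_n(r_n,\omega))$ is an $\eta$-approximate coarse correlated equilibrium of the game $u$. The mechanism is $(\varepsilon,\delta)$-jointly differentially private if for every player $i$, all profiles $u,u'$ that differ only in the type of player $i$, and every measurable set $B\subseteq\prod_{j\ne i}R_j$, $$\Pr[\mathcal M(u)_{-i}\in B]\le e^{\varepsilon}\Pr[\mathcal M(u')_{-i}\in B]+\delta .$$ (This is implied by ordinary $(\varepsilon,\delta)$-differential privacy.) **Corollary.** For all $K>0$ and $E\in\mathbb R$ there is a constant $c>0$ such that for every sequence $\delta_n\to 0$ there is $n_0$ with the following property. If $n\ge n_0$, $\varepsilon\le E$, and $\mathcal M$ is an $(\varepsilon,\delta_n)$-jointly differentially private mechanism that computes an $\eta$-approximate coarse correlated equilibrium in all $n$-player $2$-action games with $K/n$-sensitive utility functions with values in $[0,1]$, then $$\eta\ \ge\ \frac{c}{\sqrt{n\log n}} .$$ -/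

import Mathlib

open MeasureTheory

universe u v w

/-- A utility function `f` of player `i` is `lam`-sensitive if any change of the action of any
single other player changes it by at most `lam`.  The dependence on the player's own action is
unrestricted. -/
def IsSensitiveFor {n : ℕ} {A : Type*} (lam : ℝ) (i : Fin n) (f : (Fin n → A) → ℝ) : Prop :=
  ∀ j : Fin n, j ≠ i → ∀ (a : Fin n → A) (x y : A),
    |f (Function.update a j x) - f (Function.update a j y)| ≤ lam

/-- The types of player `i` in `n`-player `2`-action games: all `lam`-sensitive utility functions,
normalised to take values in `[0, 1]`.  A profile of such types is a `lam`-large game. -/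
def LargeUtility (n : ℕ) (lam : ℝ) (i : Fin n) : Type :=
  {f : (Fin n → Bool) → ℝ // (∀ a, f a ∈ Set.Icc (0 : ℝ) 1) ∧ IsSensitiveFor lam i f}

/-- The distribution `P` over action profiles is an `η`-approximate coarse correlated equilibrium
of the complete-information game with utility functions `f i`: no player gains more than `η` in
expectation by a deviation to a fixed action. -/
def IsCoarseCorrelatedEq {n : ℕ} {A : Type*} [MeasurableSpace A] (η : ℝ)
    (f : Fin n → (Fin n → A) → ℝ) (P : Measure (Fin n → A)) : Prop :=
  ∀ (i : Fin n) (b : A), ∫ a, f i (Function.update a i b) ∂P - η ≤ ∫ a, f i a ∂P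

/-- A randomized mechanism that on every reported type profile `τ` draws an output profile
`r ∼ out τ`, where `r i : R i` is sent to player `i`.  The output designates a (correlated)
distribution over action profiles: a correlating device draws `ω ∼ device`, independently of
`r` and not depending on `τ`, and player `i` plays `act i (r i) ω`.

* Suggested actions: `R i = A`, `Ω` is a point and `act i (r i) ω = r i`.
* Sequences of `T` mixed strategies, interpreted as the uniform average over `t` of the product
  distributions: `r i = (π i 1, …, π i T)`, `ω` consists of a uniform round `t` and of independent
  uniform reals `ω i`, and `act i (r i) ω` samples from `π i t` by means of `ω i`. -/
structure Mechanism {n : ℕ} (Θ : Fin n → Type w) (R : Fin n → Type u)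
    [∀ i, MeasurableSpace (R i)] (Ω : Type v) [MeasurableSpace Ω] (A : Type) [MeasurableSpace A]
    where
  out : (∀ i, Θ i) → ProbabilityMeasure (∀ i, R i)
  device : ProbabilityMeasure Ω
  act : ∀ i, R i → Ω → A
  measurable_act : ∀ i, Measurable (fun p : R i × Ω => act i p.1 p.2)

namespace Mechanism

variable {n : ℕ} {Θ : Fin n → Type w} {R : Fin n → Type u} [∀ i, MeasurableSpace (R i)]
  {Ω : Type v} [MeasurableSpace Ω] {A : Type} [MeasurableSpace A]

/-- `(ε, δ)`-joint differential privacy: a unilateral change of the report of player `i` hardly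
changes the joint distribution of the outputs sent to all the other players. -/
def IsJointDP (M : Mechanism Θ R Ω A) (ε δ : ℝ) : Prop :=
  ∀ (i : Fin n) (τ τ' : ∀ j, Θ j), (∀ j, j ≠ i → τ j = τ' j) →
    ∀ B : Set (∀ j : {j : Fin n // j ≠ i}, R j), MeasurableSet B →
      (M.out τ : Measure (∀ j, R j)).real {r | (fun j : {j : Fin n // j ≠ i} => r j) ∈ B} ≤
        Real.exp ε *
          (M.out τ' : Measure (∀ j, R j)).real {r | (fun j : {j : Fin n // j ≠ i} => r j) ∈ B} + δ

/-- The distribution over action profiles that results when the mechanism is run on `τ`. -/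
noncomputable def play (M : Mechanism Θ R Ω A) (τ : ∀ i, Θ i) : Measure (Fin n → A) :=
  ((M.out τ : Measure (∀ i, R i)).prod (M.device : Measure Ω)).map
    (fun p i => M.act i (p.1 i) p.2)

end Mechanism

/-- The mechanism computes an `η`-approximate coarse correlated equilibrium of every `n`-player
`2`-action game with `lam`-sensitive utility functions: types are utility functions, and on every
profile of them the resulting play is such an equilibrium of the game given by this profile.
Regret is affine in the distribution of play, so this holds in particular if every single
output designates an `η`-approximate coarse correlated equilibrium. -/
def ComputesCoarseCorrelatedEq {n : ℕ} {lam : ℝ} {R : Fin n → Type u}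
    [∀ i, MeasurableSpace (R i)] {Ω : Type v} [MeasurableSpace Ω]
    (M : Mechanism (LargeUtility n lam) R Ω Bool) (η : ℝ) : Prop :=
  ∀ τ : ∀ i, LargeUtility n lam i, IsCoarseCorrelatedEq η (fun i => (τ i).1) (M.play τ)

/-! The proof is a reconstruction attack. Let `d = 2 ^ k` data players each hold a hidden bit that
they are paid to play. For each row `q` of the Sylvester matrix of order `d`, a constant number of
query players are paid for telling on which side of the thresholds `Δ * m`, `|m| ≤ N`, the row sum
of the data players' signs lies. Here `d` is of order `n`, and `Δ` is a small multiple of `√d`, the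
typical size of a row sum.

In an `η`-equilibrium data players rarely err, and a query player's expected error, weighted by its
distance to the threshold, is `O(η n)` since payoffs are scaled by `K / (2 n)`
(`integral_query_error_le`). The answers thus determine each row sum up to a mean square error of a
small constant times `d`, once `η √n` is small and the hidden bits are averaged (`sq_decode_sub_le`,
`integral_sq_rowEstimate_sub_le`). Inverting the matrix turns this into an estimate of the bits that
is wrong on a small fraction of them (`sum_wrong_bits_le`).

The estimate never looks at data players' actions. By joint privacy, flipping bit `j` hardly changes
the estimate of bit `j`, so on average a fraction of at least `(1 - δ) / (1 + exp ε)` of the bits is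
wrong (`le_sum_wrong_bits_of_isJointDP`). The two bounds clash unless `η` is at least a constant
over `√n`; the logarithm in the theorem is slack. -/

/-- The sign `±1` attached to a Boolean. -/
def boolSign (b : Bool) : ℝ := if b then 1 else -1

@[simp] lemma boolSign_not (b : Bool) : boolSign (!b) = -boolSign b := by
  cases b <;> simp [boolSign]

lemma boolSign_eq (b : Bool) : boolSign b = 1 ∨ boolSign b = -1 := by
  cases b <;> simp [boolSign]

lemma abs_boolSign (b : Bool) : |boolSign b| = 1 := by
  cases b <;> simp [boolSign]

lemma boolSign_mul_self (b : Bool) : boolSign b * boolSign b = 1 := by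
  cases b <;> simp [boolSign]

/-! ### Moments of signed sums over the Boolean cube -/

section Cube

variable {D : Type*} [DecidableEq D]

/-- Flip the bit at position `j`. -/
def flipBit (j : D) (x : D → Bool) : D → Bool := Function.update x j (!x j)

@[simp] lemma flipBit_same (j : D) (x : D → Bool) : flipBit j x j = !x j := by
  simp [flipBit]

lemma flipBit_of_ne {i j : D} (h : i ≠ j) (x : D → Bool) : flipBit j x i = x i := by
  simp [flipBit, h]

lemma flipBit_involutive (j : D) : Function.Involutive (flipBit j) := by
  intro x
  ext i
  by_cases h : i = j
  · subst h; simp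
  · simp [flipBit_of_ne h]

lemma sum_signs_flipBit {s : Finset D} {j : D} (hj : j ∉ s) (w : D → ℝ) (x : D → Bool) :
    ∑ i ∈ s, w i * boolSign (flipBit j x i) = ∑ i ∈ s, w i * boolSign (x i) :=
  Finset.sum_congr rfl fun i hi => by
    rw [flipBit_of_ne (ne_of_mem_of_not_mem hi hj)]

variable [Fintype D]

lemma sum_flipBit (j : D) (F : (D → Bool) → ℝ) : ∑ x, F (flipBit j x) = ∑ x, F x :=
  Fintype.sum_equiv (flipBit_involutive j).toPerm _ _ fun _ => rfl

lemma sum_cube_sq (w : D → ℝ) (hw : ∀ i, w i ^ 2 = 1) (s : Finset D) :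
    ∑ x : D → Bool, (∑ i ∈ s, w i * boolSign (x i)) ^ 2
      = s.card * (Fintype.card (D → Bool) : ℝ) := by
  induction s using Finset.induction_on with
  | empty => simp
  | insert j s hj ih =>
    have key : ∀ c : ℝ, c = -c → c = 0 := fun c h => by linarith
    -- Flipping bit `j` permutes the cube and negates each summand.
    have hodd : ∑ x : D → Bool, (w j * boolSign (x j)) * ∑ i ∈ s, w i * boolSign (x i) = 0 := by
      apply key
      conv_lhs => rw [← sum_flipBit j]
      simp only [sum_signs_flipBit hj, flipBit_same, boolSign_not]
      rw [← Finset.sum_neg_distrib]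
      exact Finset.sum_congr rfl fun x _ => by ring
    have hexp : ∀ x : D → Bool, (∑ i ∈ insert j s, w i * boolSign (x i)) ^ 2
        = (∑ i ∈ s, w i * boolSign (x i)) ^ 2
          + 2 * ((w j * boolSign (x j)) * ∑ i ∈ s, w i * boolSign (x i)) + 1 := by
      intro x
      rw [Finset.sum_insert hj]
      linear_combination (boolSign (x j) * boolSign (x j)) * hw j + boolSign_mul_self (x j)
    simp only [hexp, Finset.sum_add_distrib, ← Finset.mul_sum, hodd, ih,
      Finset.card_insert_of_notMem hj]
    simp
    ring

lemma sum_cube_pow_four_le (w : D → ℝ) (hw : ∀ i, w i ^ 2 = 1) (s : Finset D) :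
    ∑ x : D → Bool, (∑ i ∈ s, w i * boolSign (x i)) ^ 4
      ≤ 3 * (s.card : ℝ) ^ 2 * (Fintype.card (D → Bool) : ℝ) := by
  induction s using Finset.induction_on with
  | empty => simp
  | insert j s hj ih =>
    have key : ∀ c : ℝ, c = -c → c = 0 := fun c h => by linarith
    have hodd : ∑ x : D → Bool, (w j * boolSign (x j)) *
        ((∑ i ∈ s, w i * boolSign (x i)) ^ 3 + ∑ i ∈ s, w i * boolSign (x i)) = 0 := by
      apply key
      conv_lhs => rw [← sum_flipBit j]
      simp only [sum_signs_flipBit hj, flipBit_same, boolSign_not]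
      rw [← Finset.sum_neg_distrib]
      exact Finset.sum_congr rfl fun x _ => by ring
    have hexp : ∀ x : D → Bool, (∑ i ∈ insert j s, w i * boolSign (x i)) ^ 4
        = (∑ i ∈ s, w i * boolSign (x i)) ^ 4
          + 4 * ((w j * boolSign (x j)) *
            ((∑ i ∈ s, w i * boolSign (x i)) ^ 3 + ∑ i ∈ s, w i * boolSign (x i)))
          + 6 * (∑ i ∈ s, w i * boolSign (x i)) ^ 2 + 1 := by
      intro x
      rw [Finset.sum_insert hj]
      have h2 : (w j * boolSign (x j)) ^ 2 = 1 := by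
        linear_combination (boolSign (x j) * boolSign (x j)) * hw j + boolSign_mul_self (x j)
      set S := ∑ i ∈ s, w i * boolSign (x i)
      set u := w j * boolSign (x j)
      linear_combination (6 * S ^ 2 + 4 * S * u + u ^ 2 + 1) * h2
    simp only [hexp, Finset.sum_add_distrib, ← Finset.mul_sum, hodd, sum_cube_sq w hw,
      Finset.card_insert_of_notMem hj]
    have hC : (0 : ℝ) ≤ (Fintype.card (D → Bool) : ℝ) := Nat.cast_nonneg _
    push_cast
    simp only [Finset.sum_const, Finset.card_univ, nsmul_eq_mul, mul_one]
    linarith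

end Cube

/-! ### Orthogonality of the Sylvester matrix -/

section Sylvester

variable {k : ℕ}

/-- The entries of the Sylvester-Hadamard matrix of order `2 ^ k`. -/
def sylvester (q i : Fin k → Bool) : ℝ := ∏ l, (if q l && i l then -1 else 1)

lemma sylvester_comm (q i : Fin k → Bool) : sylvester q i = sylvester i q := by
  simp only [sylvester, Bool.and_comm]

lemma sylvester_sq (q i : Fin k → Bool) : sylvester q i ^ 2 = 1 := by
  rw [sylvester, ← Finset.prod_pow]
  exact Finset.prod_eq_one fun l _ => by split_ifs <;> norm_num

lemma abs_sylvester (q i : Fin k → Bool) : |sylvester q i| = 1 := by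
  have := sylvester_sq q i
  rw [← sq_abs] at this
  exact (pow_eq_one_iff_of_nonneg (abs_nonneg _) two_ne_zero).1 this

lemma sum_sylvester_mul (i j : Fin k → Bool) :
    ∑ q, sylvester q i * sylvester q j = if i = j then (2 : ℝ) ^ k else 0 := by
  have h : ∑ q : Fin k → Bool, sylvester q i * sylvester q j
      = ∏ l, ∑ b : Bool, ((if b && i l then (-1 : ℝ) else 1) * (if b && j l then -1 else 1)) := by
    rw [Finset.prod_univ_sum, Fintype.piFinset_univ]
    simp only [sylvester, Finset.prod_mul_distrib]
  rw [h]
  split_ifs with hij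
  · subst hij
    have : ∀ l, ∑ b : Bool, ((if b && i l then (-1 : ℝ) else 1) * (if b && i l then -1 else 1))
        = 2 := by
      intro l
      cases i l <;> norm_num
    rw [Finset.prod_congr rfl fun l _ => this l]
    simp
  · obtain ⟨l, hl⟩ := Function.ne_iff.1 hij
    refine Finset.prod_eq_zero (Finset.mem_univ l) ?_
    revert hl
    cases i l <;> cases j l <;> norm_num

lemma sylvester_inversion (y : (Fin k → Bool) → ℝ) (j : Fin k → Bool) :
    ∑ q, sylvester q j * ∑ i, sylvester q i * y i = 2 ^ k * y j := by
  simp only [Finset.mul_sum]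
  rw [Finset.sum_comm]
  have : ∀ i, ∑ q, sylvester q j * (sylvester q i * y i)
      = (if j = i then (2 : ℝ) ^ k else 0) * y i := by
    intro i
    rw [← sum_sylvester_mul, Finset.sum_mul]
    exact Finset.sum_congr rfl fun q _ => by ring
  simp [this]

lemma sylvester_parseval (v : (Fin k → Bool) → ℝ) :
    ∑ j, (∑ q, sylvester q j * v q) ^ 2 = 2 ^ k * ∑ q, v q ^ 2 := by
  have h : ∀ j, (∑ q, sylvester q j * v q) ^ 2
      = ∑ q, v q * (sylvester j q * ∑ p, sylvester j p * v p) := by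
    intro j
    rw [sq, Finset.sum_mul]
    simp only [fun q => sylvester_comm q j]
    exact Finset.sum_congr rfl fun q _ => by ring
  simp only [h]
  rw [Finset.sum_comm]
  simp only [← Finset.mul_sum, sylvester_inversion]
  rw [Finset.mul_sum]
  exact Finset.sum_congr rfl fun q _ => by ring

end Sylvester

/-! ### Decoding a real number from threshold answers -/

section Thresholds

open Finset

lemma sum_threshold_signs {N : ℕ} {z : ℝ} (hz : |z| ≤ N) :
    ∑ k ∈ Icc (-(N : ℤ)) N, (if (k : ℝ) ≤ z then (1 : ℝ) else -1) = 2 * ⌊z⌋ + 1 := by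
  obtain ⟨h1, h2⟩ := abs_le.1 hz
  have hl : -(N : ℤ) ≤ ⌊z⌋ := Int.le_floor.2 (by push_cast; exact h1)
  have hu : ⌊z⌋ ≤ N := by
    have := (Int.floor_le z).trans h2
    exact_mod_cast this
  have hsplit : ∀ k : ℤ, (if (k : ℝ) ≤ z then (1 : ℝ) else -1)
      = 2 * (if k ≤ ⌊z⌋ then 1 else 0) - 1 := by
    intro k
    simp only [Int.le_floor]
    split_ifs <;> norm_num
  simp only [hsplit, Finset.sum_sub_distrib, ← Finset.mul_sum, Finset.sum_boole]
  have hf : (Icc (-(N : ℤ)) N).filter (fun k => k ≤ ⌊z⌋) = Icc (-(N : ℤ)) ⌊z⌋ := by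
    ext k
    simp only [mem_filter, mem_Icc]
    omega
  have c1 : ((Icc (-(N : ℤ)) ⌊z⌋).card : ℝ) = ⌊z⌋ + 1 + N := by
    rw [Int.card_Icc]
    have : ((⌊z⌋ + 1 - -(N : ℤ)).toNat : ℤ) = ⌊z⌋ + 1 + N := by omega
    exact_mod_cast this
  have c2 : ((Icc (-(N : ℤ)) N).card : ℝ) = 2 * N + 1 := by
    rw [Int.card_Icc]
    have : (((N : ℤ) + 1 - -(N : ℤ)).toNat : ℤ) = 2 * N + 1 := by omega
    exact_mod_cast this
  rw [hf, c1]
  simp only [sum_const, nsmul_eq_mul, mul_one]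
  rw [c2]
  ring

lemma card_thresholds (N : ℕ) : (Icc (-(N : ℤ)) N).card = 2 * N + 1 := by
  rw [Int.card_Icc]
  omega

/-- Inside the range, half the sum of correct answers is `⌊z⌋ + 1 / 2`. Outside, the error is at
most `3 * |z|`, and `N < |z|` allows trading `z ^ 2` for `z ^ 4 / N ^ 2`, which a fourth moment
controls. -/
lemma sq_sum_threshold_signs_sub_le {N : ℕ} (hN : 1 ≤ N) (z : ℝ) :
    ((∑ k ∈ Icc (-(N : ℤ)) N, (if (k : ℝ) ≤ z then (1 : ℝ) else -1)) / 2 - z) ^ 2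
      ≤ 1 / 4 + 9 * z ^ 4 / N ^ 2 := by
  have hN' : (1 : ℝ) ≤ N := by exact_mod_cast hN
  by_cases hz : |z| ≤ N
  · rw [sum_threshold_signs hz]
    have h1 := Int.floor_le z
    have h2 := Int.lt_floor_add_one z
    have : (0 : ℝ) ≤ 9 * z ^ 4 / N ^ 2 := by positivity
    nlinarith
  · push Not at hz
    set g := ∑ k ∈ Icc (-(N : ℤ)) N, (if (k : ℝ) ≤ z then (1 : ℝ) else -1)
    have hg : |g| ≤ 2 * N + 1 := by
      refine (abs_sum_le_sum_abs _ _).trans ?_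
      have : ∀ k ∈ Icc (-(N : ℤ)) N, |(if (k : ℝ) ≤ z then (1 : ℝ) else -1)| ≤ 1 := by
        intro k _
        split_ifs <;> simp
      refine (sum_le_card_nsmul _ _ 1 this).trans ?_
      rw [card_thresholds]
      simp
    have h3 : |g / 2 - z| ≤ 3 * |z| := by
      refine (abs_sub _ _).trans ?_
      rw [abs_div, abs_two]
      linarith
    have h4 : (g / 2 - z) ^ 2 ≤ 9 * z ^ 2 := by
      rw [← sq_abs, ← sq_abs z]
      nlinarith [abs_nonneg (g / 2 - z)]
    have h5 : z ^ 2 ≤ z ^ 4 / N ^ 2 := by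
      rw [le_div_iff₀ (by positivity)]
      have : (N : ℝ) ^ 2 ≤ z ^ 2 := by
        rw [← sq_abs z]
        exact pow_le_pow_left₀ (by positivity) hz.le 2
      nlinarith [sq_nonneg z]
    rw [mul_div_assoc]
    linarith

/-- Decoding a real number from the (mostly correct) answers to threshold questions. -/
lemma sq_decode_sub_le {N : ℕ} (hN : 1 ≤ N) (z : ℝ) (s : ℤ → ℝ) (hs : ∀ k, s k = 1 ∨ s k = -1) :
    ((∑ k ∈ Icc (-(N : ℤ)) N, s k) / 2 - z) ^ 2
      ≤ 5 + 4 * (2 * N + 1) * ∑ k ∈ Icc (-(N : ℤ)) N, (|z - k| - s k * (z - k))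
        + 18 * z ^ 4 / N ^ 2 := by
  set I := Icc (-(N : ℤ)) N with hI
  set σ : ℤ → ℝ := fun k => if (k : ℝ) ≤ z then (1 : ℝ) else -1 with hσ
  -- A wrong answer near the threshold costs little, but at most one threshold is that near. Any
  -- other wrong answer has weighted error `2 * |z - k| ≥ 1`.
  set near : ℤ → ℝ := fun k => if |z - k| < 1 / 2 then 1 else 0 with hnear
  set far : ℤ → ℝ := fun k => if |z - k| < 1 / 2 then 0 else |s k - σ k| / 2 with hfar
  have hfar0 : ∀ k, 0 ≤ far k := by
    intro k
    simp only [hfar]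
    split_ifs <;> positivity
  have hdiff : ∀ k, |s k - σ k| ≤ 2 := by
    intro k
    simp only [hσ]
    rcases hs k with h | h <;> rw [h] <;> split_ifs <;> norm_num
  have hpt : ∀ k, |s k - σ k| ≤ 2 * near k + 2 * far k := by
    intro k
    have := hdiff k
    simp only [hnear, hfar]
    split_ifs <;> linarith
  have hfar1 : ∀ k, far k ≤ 1 := by
    intro k
    have := hdiff k
    simp only [hfar]
    split_ifs <;> linarith
  have hfarW : ∀ k, far k ≤ |z - k| - s k * (z - k) := by
    intro k
    have hab := le_abs_self (z - k)
    have hab' := neg_abs_le (z - k)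
    simp only [hfar, hσ]
    by_cases hk : (k : ℝ) ≤ z
    · rw [abs_of_nonneg (sub_nonneg.2 hk)]
      rcases hs k with h | h <;> rw [h] <;> split_ifs <;> norm_num <;> linarith
    · push Not at hk
      rw [abs_of_neg (sub_neg.2 hk)]
      rcases hs k with h | h <;> rw [h] <;> split_ifs <;> norm_num <;> linarith
  have hnear1 : ∑ k ∈ I, near k ≤ 1 := by
    simp only [hnear, sum_boole]
    have : (I.filter (fun k : ℤ => |z - k| < 1 / 2)).card ≤ 1 := by
      refine card_le_one.2 fun a ha b hb => ?_
      have ha' := abs_lt.1 (mem_filter.1 ha).2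
      have hb' := abs_lt.1 (mem_filter.1 hb).2
      have h1 : (a : ℝ) < b + 1 := by linarith
      have h2 : (b : ℝ) < a + 1 := by linarith
      have h1' : a < b + 1 := by exact_mod_cast h1
      have h2' : b < a + 1 := by exact_mod_cast h2
      omega
    exact_mod_cast this
  set F := ∑ k ∈ I, far k with hF
  set W := ∑ k ∈ I, (|z - k| - s k * (z - k)) with hW
  have hF0 : 0 ≤ F := sum_nonneg fun k _ => hfar0 k
  have hFM : F ≤ 2 * N + 1 := by
    refine (sum_le_card_nsmul _ _ 1 fun k _ => hfar1 k).trans ?_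
    rw [hI, card_thresholds]
    simp
  have hFW : F ≤ W := sum_le_sum fun k _ => hfarW k
  have hsub : |(∑ k ∈ I, s k) / 2 - (∑ k ∈ I, σ k) / 2| ≤ 1 + F := by
    rw [← sub_div, ← sum_sub_distrib, abs_div, abs_two]
    have : |∑ k ∈ I, (s k - σ k)| ≤ 2 * ∑ k ∈ I, near k + 2 * F := by
      refine (abs_sum_le_sum_abs _ _).trans ((sum_le_sum fun k _ => hpt k).trans ?_)
      rw [sum_add_distrib, ← mul_sum, ← mul_sum]
    linarith
  have hg : ((∑ k ∈ I, σ k) / 2 - z) ^ 2 ≤ 1 / 4 + 9 * z ^ 4 / N ^ 2 :=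
    sq_sum_threshold_signs_sub_le hN z
  set p := (∑ k ∈ I, s k) / 2
  set g := (∑ k ∈ I, σ k) / 2
  have h1 : (p - g) ^ 2 ≤ 2 + 2 * F ^ 2 := by
    rw [← sq_abs]
    nlinarith [abs_nonneg (p - g), sq_nonneg (F - 1)]
  -- One factor `F` is bounded by the number of thresholds, so that the bound is linear in `W` and
  -- survives taking expectations.
  have h2 : F ^ 2 ≤ (2 * N + 1) * W := by
    rw [sq]
    exact mul_le_mul hFM hFW hF0 (by positivity)
  have h3 : 18 * z ^ 4 / (N : ℝ) ^ 2 = 2 * (9 * z ^ 4 / N ^ 2) := by ring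
  rw [h3]
  nlinarith [sq_nonneg ((p - g) - (g - z))]

end Thresholds

/-! ### Privacy of the resulting play -/

lemma measureReal_prod_eq_integral {α β : Type*} [MeasurableSpace α] [MeasurableSpace β]
    (μ : Measure α) (ν : Measure β) [IsFiniteMeasure μ] [IsFiniteMeasure ν]
    {s : Set (α × β)} (hs : MeasurableSet s) :
    (μ.prod ν).real s = ∫ y, μ.real ((fun x => (x, y)) ⁻¹' s) ∂ν := by
  rw [measureReal_def, Measure.prod_apply_symm hs]
  exact (integral_toReal (measurable_measure_prodMk_right hs).aemeasurable
    (Filter.Eventually.of_forall fun _ => measure_lt_top _ _)).symm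

namespace Mechanism

variable {n : ℕ} {Θ : Fin n → Type w} {R : Fin n → Type u} [∀ i, MeasurableSpace (R i)]
  {Ω : Type v} [MeasurableSpace Ω]

lemma measurable_play {A : Type} [MeasurableSpace A] (M : Mechanism Θ R Ω A) :
    Measurable (fun (p : (∀ i, R i) × Ω) i => M.act i (p.1 i) p.2) :=
  measurable_pi_lambda _ fun i => (M.measurable_act i).comp
    (((measurable_pi_apply i).comp measurable_fst).prodMk measurable_snd)

instance isProbabilityMeasure_play {A : Type} [MeasurableSpace A] (M : Mechanism Θ R Ω A)
    (τ : ∀ i, Θ i) : IsProbabilityMeasure (M.play τ) :=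
  Measure.isProbabilityMeasure_map M.measurable_play.aemeasurable

/-- Joint differential privacy passes to events that only involve the actions of the others. -/
lemma IsJointDP.play_le {M : Mechanism Θ R Ω Bool} {ε δ : ℝ} (hM : M.IsJointDP ε δ)
    (i : Fin n) {τ τ' : ∀ j, Θ j} (hτ : ∀ j, j ≠ i → τ j = τ' j) (B : Set (Fin n → Bool))
    (hB : ∀ a b : Fin n → Bool, (∀ j, j ≠ i → a j = b j) → a ∈ B → b ∈ B) :
    (M.play τ).real B ≤ Real.exp ε * (M.play τ').real B + δ := by
  classical
  have hBm : MeasurableSet B := B.toFinite.measurableSet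
  have hpre := M.measurable_play hBm
  have hplay : ∀ σ, (M.play σ).real B = ∫ ω, (M.out σ : Measure (∀ j, R j)).real
      {r | (fun j => M.act j (r j) ω) ∈ B} ∂(M.device : Measure Ω) := by
    intro σ
    rw [play, map_measureReal_apply M.measurable_play hBm, measureReal_prod_eq_integral _ _ hpre]
    rfl
  have hint : ∀ σ, Integrable (fun ω => (M.out σ : Measure (∀ j, R j)).real
      {r | (fun j => M.act j (r j) ω) ∈ B}) (M.device : Measure Ω) := by
    intro σ
    refine Integrable.of_bound (C := 1)
      (measurable_measure_prodMk_right hpre).ennreal_toReal.aestronglyMeasurable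
      (Filter.Eventually.of_forall fun ω => ?_)
    rw [Real.norm_of_nonneg measureReal_nonneg]
    exact measureReal_le_one
  have hstep : ∀ ω, (M.out τ : Measure (∀ j, R j)).real {r | (fun j => M.act j (r j) ω) ∈ B}
      ≤ Real.exp ε * (M.out τ' : Measure (∀ j, R j)).real
          {r | (fun j => M.act j (r j) ω) ∈ B} + δ := by
    intro ω
    -- With `ω` fixed, play is a function of the outputs. Player `i` gets the dummy action `true`,
    -- which is harmless because membership in `B` ignores coordinate `i`.
    let ext : (∀ j : {j : Fin n // j ≠ i}, R j) → Fin n → Bool :=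
      fun s j => if h : j ≠ i then M.act j (s ⟨j, h⟩) ω else true
    have hext : Measurable ext := by
      refine measurable_pi_lambda _ fun j => ?_
      by_cases h : j ≠ i
      · simp only [ext, dif_pos h]
        have hj : Measurable fun s : ∀ j : {j : Fin n // j ≠ i}, R j => (s ⟨j, h⟩, ω) :=
          (measurable_pi_apply _).prodMk measurable_const
        exact (M.measurable_act j).comp hj
      · simp only [ext, dif_neg h]
        exact measurable_const
    have heq : {r : ∀ j, R j | (fun j => M.act j (r j) ω) ∈ B}
        = {r | (fun j : {j : Fin n // j ≠ i} => r j) ∈ ext ⁻¹' B} := by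
      ext r
      have h : ∀ j, j ≠ i → M.act j (r j) ω = ext (fun j => r j) j := fun j hj => by
        simp only [ext, dif_pos hj]
      exact ⟨hB _ _ h, hB _ _ fun j hj => (h j hj).symm⟩
    rw [heq]
    exact hM i τ τ' hτ _ (hext hBm)
  rw [hplay, hplay, ← integral_const_mul]
  refine (integral_mono (hint τ) (((hint τ').const_mul _).add (integrable_const δ))
    hstep).trans_eq ?_
  refine (integral_add ((hint τ').const_mul _) (integrable_const δ)).trans ?_
  simp

end Mechanism

/-! ### The reconstruction game and its equilibria -/

/-- The thresholds `-N, …, N`. -/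
abbrev Threshold (N : ℕ) : Type := Finset.Icc (-(N : ℤ)) (N : ℤ)

/-- The roles of the players: data players, indexed by the columns of the Sylvester matrix;
query players, indexed by a row and a threshold; and `r` idle players. -/
abbrev Role (k N r : ℕ) : Type :=
  (Fin k → Bool) ⊕ ((Fin k → Bool) × Threshold N) ⊕ Fin r

section Game

variable {n k N r : ℕ}

/-- The product of row `q` of the Sylvester matrix with the sign vector of `x`. -/
def rowSum (x : (Fin k → Bool) → Bool) (q : Fin k → Bool) : ℝ :=
  ∑ j, sylvester q j * boolSign (x j)

/-- The actions of the data players. -/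
def dataActions (e : Fin n ≃ Role k N r) (a : Fin n → Bool) (j : Fin k → Bool) : Bool :=
  a (e.symm (Sum.inl j))

/-- The game in which data player `j` wants to play the bit `x j` and query player `(q, m)` wants
to tell whether row sum `q` of the data players' actions exceeds `Δ * m`. -/
noncomputable def gameUtility (e : Fin n ≃ Role k N r) (κ Δ : ℝ) (x : (Fin k → Bool) → Bool) (i : Fin n)
    (a : Fin n → Bool) : ℝ :=
  match e i with
  | Sum.inl j => if a i = x j then 1 else 0
  | Sum.inr (Sum.inl (q, m)) =>
      1 / 2 + κ * (boolSign (a i) * (rowSum (dataActions e a) q - Δ * (m : ℤ)))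
  | Sum.inr (Sum.inr _) => 0

lemma gameUtility_data (e : Fin n ≃ Role k N r) (κ Δ : ℝ) (x : (Fin k → Bool) → Bool)
    (j : Fin k → Bool) (a : Fin n → Bool) :
    gameUtility e κ Δ x (e.symm (Sum.inl j)) a
      = if a (e.symm (Sum.inl j)) = x j then 1 else 0 := by
  simp [gameUtility]

lemma gameUtility_query (e : Fin n ≃ Role k N r) (κ Δ : ℝ) (x : (Fin k → Bool) → Bool)
    (q : Fin k → Bool) (m : Threshold N) (a : Fin n → Bool) :
    gameUtility e κ Δ x (e.symm (Sum.inr (Sum.inl (q, m)))) a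
      = 1 / 2 + κ * (boolSign (a (e.symm (Sum.inr (Sum.inl (q, m)))))
          * (rowSum (dataActions e a) q - Δ * (m : ℤ))) := by
  simp [gameUtility]

lemma gameUtility_flipBit (e : Fin n ≃ Role k N r) (κ Δ : ℝ) (x : (Fin k → Bool) → Bool)
    (j : Fin k → Bool) (i : Fin n) (hi : i ≠ e.symm (Sum.inl j)) :
    gameUtility e κ Δ (flipBit j x) i = gameUtility e κ Δ x i := by
  obtain ⟨p, rfl⟩ := e.symm.surjective i
  funext a
  rcases p with j' | ⟨q, m⟩ | s
  · have h : j' ≠ j := fun h => hi (by rw [h])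
    rw [gameUtility_data, gameUtility_data, flipBit_of_ne h]
  · rw [gameUtility_query, gameUtility_query]
  · simp [gameUtility]

lemma abs_rowSum_sub_le (y y' : (Fin k → Bool) → Bool) (q : Fin k → Bool) :
    |rowSum y q - rowSum y' q| ≤ 2 * ∑ j, if y j = y' j then (0 : ℝ) else 1 := by
  rw [rowSum, rowSum, ← Finset.sum_sub_distrib, Finset.mul_sum]
  refine (Finset.abs_sum_le_sum_abs _ _).trans (Finset.sum_le_sum fun j _ => ?_)
  rw [← mul_sub, abs_mul, abs_sylvester, one_mul]
  cases y j <;> cases y' j <;> norm_num [boolSign]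

lemma abs_rowSum_le (y : (Fin k → Bool) → Bool) (q : Fin k → Bool) : |rowSum y q| ≤ 2 ^ k := by
  refine (Finset.abs_sum_le_sum_abs _ _).trans ?_
  simp [abs_mul, abs_sylvester, abs_boolSign]

lemma dataActions_update_query (e : Fin n ≃ Role k N r) (a : Fin n → Bool)
    (p : ((Fin k → Bool) × Threshold N) ⊕ Fin r) (b : Bool) :
    dataActions e (Function.update a (e.symm (Sum.inr p)) b) = dataActions e a := by
  funext j
  simp [dataActions, Function.update]

lemma gameUtility_mem_Icc (e : Fin n ≃ Role k N r) {κ Δ : ℝ} (hκ : 0 ≤ κ) (hΔ : 0 ≤ Δ)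
    (h : κ * (2 ^ k + Δ * N) ≤ 1 / 2) (x : (Fin k → Bool) → Bool) (i : Fin n)
    (a : Fin n → Bool) : gameUtility e κ Δ x i a ∈ Set.Icc (0 : ℝ) 1 := by
  obtain ⟨p, rfl⟩ := e.symm.surjective i
  rcases p with j | ⟨q, m⟩ | s
  · rw [gameUtility_data]
    split_ifs <;> simp
  · rw [gameUtility_query]
    have hm : |((m : ℤ) : ℝ)| ≤ N := by
      have := Finset.mem_Icc.1 m.2
      rw [abs_le]
      exact ⟨by exact_mod_cast this.1, by exact_mod_cast this.2⟩
    have h1 : |rowSum (dataActions e a) q - Δ * (m : ℤ)| ≤ 2 ^ k + Δ * N := by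
      refine (abs_sub _ _).trans (add_le_add (abs_rowSum_le _ _) ?_)
      rw [abs_mul, abs_of_nonneg hΔ]
      exact mul_le_mul_of_nonneg_left hm hΔ
    have h2 : |κ * (boolSign (a (e.symm (Sum.inr (Sum.inl (q, m)))))
        * (rowSum (dataActions e a) q - Δ * (m : ℤ)))| ≤ 1 / 2 := by
      rw [abs_mul, abs_mul, abs_boolSign, one_mul, abs_of_nonneg hκ]
      exact (mul_le_mul_of_nonneg_left h1 hκ).trans h
    rw [abs_le] at h2
    constructor <;> linarith [h2.1, h2.2]
  · simp [gameUtility]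

/-- One data player moves a row sum by at most 2. Data players' payoffs depend only on their own
action, so they need no scaling by `κ`. -/
lemma gameUtility_isSensitiveFor (e : Fin n ≃ Role k N r) {κ Δ : ℝ} (hκ : 0 ≤ κ)
    (x : (Fin k → Bool) → Bool) (i : Fin n) :
    IsSensitiveFor (2 * κ) i (gameUtility e κ Δ x i) := by
  intro p hp a b b'
  obtain ⟨i, rfl⟩ := e.symm.surjective i
  rcases i with j | ⟨q, m⟩ | s
  · rw [gameUtility_data, gameUtility_data]
    simp [Function.update_of_ne hp.symm, hκ]
  · rw [gameUtility_query, gameUtility_query, Function.update_of_ne hp.symm,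
      Function.update_of_ne hp.symm, add_sub_add_left_eq_sub, ← mul_sub, ← mul_sub,
      sub_sub_sub_cancel_right, abs_mul, abs_mul, abs_boolSign, one_mul, abs_of_nonneg hκ, mul_comm]
    refine mul_le_mul_of_nonneg_right ((abs_rowSum_sub_le _ _ _).trans ?_) hκ
    suffices h : (∑ j, if dataActions e (Function.update a p b) j
        = dataActions e (Function.update a p b') j then (0 : ℝ) else 1) ≤ 1 by linarith
    have hle : ∀ j, (if dataActions e (Function.update a p b) j
        = dataActions e (Function.update a p b') j then (0 : ℝ) else 1)
        ≤ if e p = Sum.inl j then 1 else 0 := by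
      intro j
      by_cases hj : e p = Sum.inl j
      · rw [if_pos hj]
        split_ifs <;> norm_num
      · have : e.symm (Sum.inl j) ≠ p := fun h => hj (by simp [← h])
        simp [dataActions, Function.update_of_ne this, hj]
    refine (Finset.sum_le_sum fun j _ => hle j).trans ?_
    rcases e p with j | _ <;> simp
  · simp [gameUtility, hκ]

/-- The profile of types given by the game with hidden bits `x`. -/
noncomputable def gameType (e : Fin n ≃ Role k N r) {K κ Δ : ℝ} (hκ : 0 ≤ κ) (hΔ : 0 ≤ Δ)
    (h : κ * (2 ^ k + Δ * N) ≤ 1 / 2) (hK : 2 * κ = K / n) (x : (Fin k → Bool) → Bool)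
    (i : Fin n) : LargeUtility n (K / n) i :=
  ⟨gameUtility e κ Δ x i, gameUtility_mem_Icc e hκ hΔ h x i,
    hK ▸ gameUtility_isSensitiveFor e hκ x i⟩

variable {e : Fin n ≃ Role k N r} {κ Δ η : ℝ} {x : (Fin k → Bool) → Bool}
  {P : Measure (Fin n → Bool)} [IsProbabilityMeasure P]

lemma integral_data_error_le (hP : IsCoarseCorrelatedEq η (gameUtility e κ Δ x) P)
    (j : Fin k → Bool) : ∫ a, (if dataActions e a j = x j then (0 : ℝ) else 1) ∂P ≤ η := by
  have h := hP (e.symm (Sum.inl j)) (x j)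
  simp only [gameUtility_data, Function.update_self, if_true, integral_const, probReal_univ,
    one_smul] at h
  have h2 : ∀ a, (if dataActions e a j = x j then (0 : ℝ) else 1)
      = 1 - if a (e.symm (Sum.inl j)) = x j then 1 else 0 := by
    intro a
    by_cases hx : a (e.symm (Sum.inl j)) = x j <;> simp [dataActions, hx]
  simp only [h2]
  rw [integral_sub (integrable_const _) .of_finite]
  simp only [integral_const, probReal_univ, one_smul]
  linarith

/-- The answer of query player `(q, m)`. -/
noncomputable def queryAnswer (e : Fin n ≃ Role k N r) (a : Fin n → Bool) (q : Fin k → Bool) (m : ℤ) : ℝ :=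
  if h : m ∈ Finset.Icc (-(N : ℤ)) N then
    boolSign (a (e.symm (Sum.inr (Sum.inl (q, ⟨m, h⟩))))) else 1

lemma queryAnswer_eq (e : Fin n ≃ Role k N r) (a : Fin n → Bool) (q : Fin k → Bool) (m : ℤ) :
    queryAnswer e a q m = 1 ∨ queryAnswer e a q m = -1 := by
  rw [queryAnswer]
  split_ifs
  · exact boolSign_eq _
  · exact Or.inl rfl

/-- Compare with the fixed answer that is correct for the hidden bits `x`. Its regret contributes `η
/ κ`. Replacing the played row sum by that of `x` costs at most 4 per erring data player: 2 in the
row sum, times 2 for the difference of the two answers. -/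
lemma integral_query_error_le (hκ : 0 < κ) (hP : IsCoarseCorrelatedEq η (gameUtility e κ Δ x) P)
    (q : Fin k → Bool) {m : ℤ} (hm : m ∈ Finset.Icc (-(N : ℤ)) N) :
    ∫ a, (|rowSum x q - Δ * m| - queryAnswer e a q m * (rowSum x q - Δ * m)) ∂P
      ≤ η * (1 / κ + 4 * 2 ^ k) := by
  obtain ⟨b, hb⟩ : ∃ b, boolSign b * (rowSum x q - Δ * m) = |rowSum x q - Δ * m| := by
    rcases abs_choice (rowSum x q - Δ * m) with h | h
    · exact ⟨true, by rw [h]; simp [boolSign]⟩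
    · exact ⟨false, by rw [h]; simp [boolSign]⟩
  set i := e.symm (Sum.inr (Sum.inl (q, (⟨m, hm⟩ : Threshold N)))) with hi
  have hpt : ∀ a, |rowSum x q - Δ * m| - queryAnswer e a q m * (rowSum x q - Δ * m)
      ≤ 1 / κ * (gameUtility e κ Δ x i (Function.update a i b) - gameUtility e κ Δ x i a)
        + 4 * ∑ j, if dataActions e a j = x j then (0 : ℝ) else 1 := by
    intro a
    rw [gameUtility_query, gameUtility_query, dataActions_update_query, ← hi,
      Function.update_self, ← hb, queryAnswer, dif_pos hm, ← hi]
    have h1 := abs_rowSum_sub_le (dataActions e a) x q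
    set S := ∑ j, if dataActions e a j = x j then (0 : ℝ) else 1
    have h2 : 1 / κ * (1 / 2 + κ * (boolSign b * (rowSum (dataActions e a) q - Δ * m))
        - (1 / 2 + κ * (boolSign (a i) * (rowSum (dataActions e a) q - Δ * m))))
        = (boolSign b - boolSign (a i)) * (rowSum (dataActions e a) q - Δ * m) := by
      field_simp
      ring
    rw [h2]
    obtain ⟨h3, h4⟩ := abs_le.1 h1
    rcases boolSign_eq b with h | h <;> rcases boolSign_eq (a i) with h' | h' <;>
      rw [h, h'] <;> linarith
  refine (integral_mono .of_finite .of_finite hpt).trans ?_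
  rw [integral_add .of_finite .of_finite, integral_const_mul, integral_const_mul,
    integral_sub .of_finite .of_finite, integral_finsetSum _ fun _ _ => .of_finite]
  have h1 := hP i b
  have h2 : ∑ j, ∫ a, (if dataActions e a j = x j then (0 : ℝ) else 1) ∂P ≤ 2 ^ k * η := by
    refine (Finset.sum_le_sum fun j _ => integral_data_error_le hP j).trans ?_
    simp
  have h3 : 1 / κ * (∫ a, gameUtility e κ Δ x i (Function.update a i b) ∂P
      - ∫ a, gameUtility e κ Δ x i a ∂P) ≤ 1 / κ * η :=
    mul_le_mul_of_nonneg_left (by linarith) (by positivity)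
  linarith

lemma nonneg_of_isCoarseCorrelatedEq (hP : IsCoarseCorrelatedEq η (gameUtility e κ Δ x) P) :
    0 ≤ η :=
  (integral_nonneg fun a => by split_ifs <;> norm_num).trans
    (integral_data_error_le hP fun _ => true)

/-- The estimate of row sum `q` from the query players' answers. -/
noncomputable def rowEstimate (e : Fin n ≃ Role k N r) (Δ : ℝ) (a : Fin n → Bool)
    (q : Fin k → Bool) : ℝ :=
  Δ * ((∑ m ∈ Finset.Icc (-(N : ℤ)) N, queryAnswer e a q m) / 2)

open Classical in
/-- The estimate of the hidden bits from the query players' answers. -/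
noncomputable def bitEstimate (e : Fin n ≃ Role k N r) (Δ : ℝ) (a : Fin n → Bool)
    (j : Fin k → Bool) : Bool :=
  decide (0 < ∑ q, sylvester q j * rowEstimate e Δ a q)

/-- Only query players enter the estimate, so joint privacy with respect to data player `j` applies
to it. -/
lemma bitEstimate_congr (j j' : Fin k → Bool) {a b : Fin n → Bool}
    (h : ∀ i, i ≠ e.symm (Sum.inl j) → a i = b i) :
    bitEstimate e Δ a j' = bitEstimate e Δ b j' := by
  have : rowEstimate e Δ a = rowEstimate e Δ b := by
    funext q
    simp only [rowEstimate, queryAnswer]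
    congr! 5
    rw [h _ (by simp)]
  rw [bitEstimate, bitEstimate, this]

/-- With exact row sums the inversion yields `2 ^ k` times the sign, so a wrong bit means an error
of at least `2 ^ k` in that coordinate. Parseval bounds the sum of the squared errors. -/
lemma sum_wrong_bits_le (a : Fin n → Bool) :
    ∑ j, (if bitEstimate e Δ a j = x j then (0 : ℝ) else 1)
      ≤ 1 / 2 ^ k * ∑ q, (rowEstimate e Δ a q - rowSum x q) ^ 2 := by
  have hd : (0 : ℝ) < 2 ^ k := by positivity
  have hpt : ∀ j, (2 ^ k) ^ 2 * (if bitEstimate e Δ a j = x j then (0 : ℝ) else 1)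
      ≤ (∑ q, sylvester q j * (rowEstimate e Δ a q - rowSum x q)) ^ 2 := by
    intro j
    have hS : ∑ q, sylvester q j * (rowEstimate e Δ a q - rowSum x q)
        = ∑ q, sylvester q j * rowEstimate e Δ a q - 2 ^ k * boolSign (x j) := by
      rw [← sylvester_inversion (fun j => boolSign (x j)) j, ← Finset.sum_sub_distrib]
      exact Finset.sum_congr rfl fun q _ => mul_sub _ _ _
    rw [hS, bitEstimate]
    set S := ∑ q, sylvester q j * rowEstimate e Δ a q
    by_cases h : 0 < S <;> cases x j <;> simp [h, boolSign] <;> nlinarith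
  rw [one_div, ← div_eq_inv_mul, le_div_iff₀ hd]
  have := Finset.sum_le_sum fun j (_ : j ∈ Finset.univ) => hpt j
  rw [← Finset.mul_sum, sylvester_parseval] at this
  nlinarith

lemma integral_sq_rowEstimate_sub_le (hκ : 0 < κ) (hΔ : 0 < Δ) (hN : 1 ≤ N)
    (hP : IsCoarseCorrelatedEq η (gameUtility e κ Δ x) P) (q : Fin k → Bool) :
    ∫ a, (rowEstimate e Δ a q - rowSum x q) ^ 2 ∂P
      ≤ 5 * Δ ^ 2 + 4 * (2 * N + 1) ^ 2 * Δ * (η * (1 / κ + 4 * 2 ^ k))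
        + 18 / (Δ ^ 2 * N ^ 2) * rowSum x q ^ 4 := by
  have hpt : ∀ a, (rowEstimate e Δ a q - rowSum x q) ^ 2
      ≤ (5 * Δ ^ 2 + 18 / (Δ ^ 2 * N ^ 2) * rowSum x q ^ 4)
        + 4 * (2 * N + 1) * Δ * ∑ m ∈ Finset.Icc (-(N : ℤ)) N,
          (|rowSum x q - Δ * m| - queryAnswer e a q m * (rowSum x q - Δ * m)) := by
    intro a
    have h := sq_decode_sub_le hN (rowSum x q / Δ) (queryAnswer e a q) (queryAnswer_eq e a q)
    have hW : ∀ m : ℤ, |rowSum x q - Δ * m| - queryAnswer e a q m * (rowSum x q - Δ * m)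
        = Δ * (|rowSum x q / Δ - m| - queryAnswer e a q m * (rowSum x q / Δ - m)) := by
      intro m
      have : rowSum x q - Δ * m = Δ * (rowSum x q / Δ - m) := by field_simp
      rw [this, abs_mul, abs_of_pos hΔ]
      ring
    have hl : (rowEstimate e Δ a q - rowSum x q) ^ 2
        = Δ ^ 2 * ((∑ m ∈ Finset.Icc (-(N : ℤ)) N, queryAnswer e a q m) / 2
          - rowSum x q / Δ) ^ 2 := by
      rw [rowEstimate, ← mul_pow, mul_sub, mul_div_cancel₀ _ hΔ.ne']
    rw [hl]
    simp only [hW, ← Finset.mul_sum]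
    refine (mul_le_mul_of_nonneg_left h (sq_nonneg Δ)).trans_eq ?_
    have hN' : (N : ℝ) ≠ 0 := by positivity
    field_simp
    ring
  refine (integral_mono .of_finite .of_finite hpt).trans ?_
  rw [integral_add .of_finite .of_finite, integral_const_mul,
    integral_finsetSum _ fun _ _ => .of_finite]
  simp only [integral_const, probReal_univ, one_smul]
  have h2 := Finset.sum_le_sum fun m hm => integral_query_error_le hκ hP q (m := m) hm
  rw [Finset.sum_const, card_thresholds, nsmul_eq_mul] at h2
  push_cast at h2
  have h3 := mul_le_mul_of_nonneg_left h2 (by positivity : 0 ≤ 4 * (2 * (N : ℝ) + 1) * Δ)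
  linarith

lemma sum_rowSum_pow_four_le (q : Fin k → Bool) :
    ∑ x : (Fin k → Bool) → Bool, rowSum x q ^ 4
      ≤ 3 * (2 ^ k) ^ 2 * (Fintype.card ((Fin k → Bool) → Bool) : ℝ) := by
  have h := sum_cube_pow_four_le (sylvester q) (sylvester_sq q) Finset.univ
  simpa [rowSum] using h

/-- The expected number of wrong bits, summed over all vectors of hidden bits. -/
lemma sum_integral_wrong_bits_le (hκ : 0 < κ) (hΔ : 0 < Δ) (hN : 1 ≤ N)
    (P : ((Fin k → Bool) → Bool) → Measure (Fin n → Bool)) [∀ x, IsProbabilityMeasure (P x)]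
    (hP : ∀ x, IsCoarseCorrelatedEq η (gameUtility e κ Δ x) (P x)) :
    ∑ x, ∑ j, ∫ a, (if bitEstimate e Δ a j = x j then (0 : ℝ) else 1) ∂(P x)
      ≤ Fintype.card ((Fin k → Bool) → Bool) *
        (5 * Δ ^ 2 + 4 * (2 * N + 1) ^ 2 * Δ * (η * (1 / κ + 4 * 2 ^ k))
          + 54 * (2 ^ k) ^ 2 / (Δ ^ 2 * N ^ 2)) := by
  set C := 5 * Δ ^ 2 + 4 * (2 * N + 1) ^ 2 * Δ * (η * (1 / κ + 4 * 2 ^ k)) with hC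
  set G : ℝ := 18 / (Δ ^ 2 * N ^ 2) with hG
  have hG0 : 0 ≤ G := by positivity
  have hx : ∀ x, ∑ j, ∫ a, (if bitEstimate e Δ a j = x j then (0 : ℝ) else 1) ∂(P x)
      ≤ 1 / 2 ^ k * ∑ q, (C + G * rowSum x q ^ 4) := by
    intro x
    rw [← integral_finsetSum _ fun _ _ => .of_finite]
    refine (integral_mono .of_finite .of_finite fun a => sum_wrong_bits_le a).trans ?_
    rw [integral_const_mul, integral_finsetSum _ fun _ _ => .of_finite]
    exact mul_le_mul_of_nonneg_left (Finset.sum_le_sum fun q _ =>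
      integral_sq_rowEstimate_sub_le hκ hΔ hN (hP x) q) (by positivity)
  refine (Finset.sum_le_sum fun x _ => hx x).trans ?_
  rw [← Finset.mul_sum, Finset.sum_comm]
  set Z : ℝ := (Fintype.card ((Fin k → Bool) → Bool) : ℝ) with hZ
  -- Row sums can be large for particular `x`; only the average over `x` makes their fourth power of
  -- order `(2 ^ k) ^ 2`.
  have hq : ∀ q, ∑ x : (Fin k → Bool) → Bool, (C + G * rowSum x q ^ 4)
      ≤ Z * (C + G * (3 * (2 ^ k) ^ 2)) := by
    intro q
    rw [Finset.sum_add_distrib, ← Finset.mul_sum, Finset.sum_const, Finset.card_univ, nsmul_eq_mul]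
    have := mul_le_mul_of_nonneg_left (sum_rowSum_pow_four_le q) hG0
    linarith
  have h := Finset.sum_le_sum fun q (_ : q ∈ Finset.univ) => hq q
  refine (mul_le_mul_of_nonneg_left h (by positivity)).trans_eq ?_
  simp only [Finset.sum_const, Finset.card_univ, nsmul_eq_mul, Fintype.card_fun, Fintype.card_fin,
    Fintype.card_bool]
  push_cast
  rw [one_div, inv_mul_cancel_left₀ (by positivity), hG]
  ring

end Game

/-! ### Privacy against reconstruction -/

section Reconstruction

variable {n k N r : ℕ} {R : Fin n → Type u} [∀ i, MeasurableSpace (R i)]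
  {Ω : Type v} [MeasurableSpace Ω]

/-- Differential privacy forces many errors in any estimate of the hidden bits. -/
lemma le_sum_wrong_bits_of_isJointDP {lam : ℝ} {M : Mechanism (LargeUtility n lam) R Ω Bool}
    {ε δ : ℝ} (hM : M.IsJointDP ε δ) (e : Fin n ≃ Role k N r) (Δ : ℝ)
    (τ : ((Fin k → Bool) → Bool) → ∀ i, LargeUtility n lam i)
    (hτ : ∀ x j i, i ≠ e.symm (Sum.inl j) → τ x i = τ (flipBit j x) i) :
    Fintype.card ((Fin k → Bool) → Bool) * 2 ^ k * (1 - δ) ≤ (1 + Real.exp ε) *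
      ∑ x, ∑ j, ∫ a, (if bitEstimate e Δ a j = x j then (0 : ℝ) else 1) ∂(M.play (τ x)) := by
  set w : ((Fin k → Bool) → Bool) → (Fin k → Bool) → ℝ := fun x j =>
    ∫ a, (if bitEstimate e Δ a j = x j then (0 : ℝ) else 1) ∂(M.play (τ x)) with hw
  have hind : ∀ (x : (Fin k → Bool) → Bool) (b : Bool) (j : Fin k → Bool),
      (M.play (τ x)).real {a | bitEstimate e Δ a j = b}
        = ∫ a, (if bitEstimate e Δ a j = b then (1 : ℝ) else 0) ∂(M.play (τ x)) := by
    intro x b j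
    rw [← integral_indicator_one (Set.toFinite _).measurableSet]
    congr 1
    funext a
    simp [Set.indicator_apply]
  -- The estimate that is correct for `x` at `j` is wrong for `flipBit j x`. Summing over `x` makes
  -- both sides involve the same error sum.
  have hpt : ∀ x j, 1 - w x j ≤ Real.exp ε * w (flipBit j x) j + δ := by
    intro x j
    have h := hM.play_le (e.symm (Sum.inl j)) (hτ x j) {a | bitEstimate e Δ a j = x j}
      fun a b hab ha => (bitEstimate_congr j j hab).symm.trans ha
    have h1 : (M.play (τ x)).real {a | bitEstimate e Δ a j = x j} = 1 - w x j := by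
      have h1' : (1 : ℝ) = ∫ _, (1 : ℝ) ∂(M.play (τ x)) := by simp
      rw [hind, hw, h1', ← integral_sub .of_finite .of_finite]
      congr 1
      funext a
      split_ifs <;> norm_num
    have h2 : (M.play (τ (flipBit j x))).real {a | bitEstimate e Δ a j = x j}
        = w (flipBit j x) j := by
      rw [hind]
      simp only [hw, flipBit_same]
      congr 1
      funext a
      cases bitEstimate e Δ a j <;> cases x j <;> simp
    rwa [h1, h2] at h
  have hj : ∀ j, Fintype.card ((Fin k → Bool) → Bool) * (1 - δ)
      ≤ (1 + Real.exp ε) * ∑ x, w x j := by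
    intro j
    have h := Finset.sum_le_sum fun x (_ : x ∈ Finset.univ) => hpt x j
    rw [Finset.sum_sub_distrib, Finset.sum_add_distrib, ← Finset.mul_sum,
      sum_flipBit j (fun x => w x j)] at h
    simp only [Finset.sum_const, Finset.card_univ, nsmul_eq_mul, mul_one] at h
    linarith
  rw [Finset.sum_comm, Finset.mul_sum]
  refine le_trans (le_of_eq ?_) (Finset.sum_le_sum fun j _ => hj j)
  rw [Finset.sum_const, Finset.card_univ, nsmul_eq_mul]
  simp only [Fintype.card_fun, Fintype.card_fin, Fintype.card_bool]
  push_cast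
  ring

end Reconstruction

/-! ### Choice of parameters and conclusion -/

lemma exists_roles {n m N : ℕ} (hm : 2 * N + 2 ≤ m) (hn : m ≤ n) :
    ∃ k r : ℕ, Nonempty (Fin n ≃ Role k N r) ∧ 2 ^ k * m ≤ n ∧ n ≤ 2 * m * 2 ^ k := by
  have hm0 : 0 < m := by omega
  have hdiv : n / m ≠ 0 := (Nat.div_pos hn hm0).ne'
  -- Each column needs `2 * N + 2` players: one data player and the `2 * N + 1` query players of a
  -- row. Rounding to a power of two loses at most a factor 2; the surplus players are idle.
  set k := Nat.log 2 (n / m)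
  have h1 : 2 ^ k * m ≤ n := (Nat.le_div_iff_mul_le hm0).1 (Nat.pow_log_le_self 2 hdiv)
  have h2 : n < 2 ^ (k + 1) * m :=
    (Nat.div_lt_iff_lt_mul hm0).1 (Nat.lt_pow_succ_log_self one_lt_two _)
  have h3 : 2 ^ k * (2 * N + 2) ≤ n := (Nat.mul_le_mul_left _ hm).trans h1
  refine ⟨k, n - 2 ^ k * (2 * N + 2), ⟨Fintype.equivOfCardEq ?_⟩, h1, ?_⟩
  · simp only [Fintype.card_fin, Fintype.card_sum, Fintype.card_prod, Fintype.card_fun,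
      Fintype.card_bool, Fintype.card_coe, card_thresholds]
    have : 2 ^ k * (2 * N + 2) = 2 ^ k + 2 ^ k * (2 * N + 1) := by ring
    omega
  · rw [pow_succ] at h2
    nlinarith

lemma query_error_bound {K n η β s γ m D N Q : ℝ} (hK : 0 < K) (hn : 0 < n) (hη : 0 ≤ η)
    (hβ : 0 < β) (hs : 0 < s) (hγ : 0 < γ) (hm : 0 < m) (hN : 0 ≤ N)
    (hQ : Q = 4 * (2 * N + 1) ^ 2 * β * (2 / K + 4) * Real.sqrt (2 * m)) (hD : D ≤ n)
    (hηn : η * Real.sqrt n ≤ γ / (3 * Q)) (hsn : Real.sqrt n ≤ Real.sqrt (2 * m) * s) :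
    4 * (2 * N + 1) ^ 2 * (β * s) * (η * (1 / (K / (2 * n)) + 4 * D)) ≤ s ^ 2 * (γ / 3) := by
  have hQ0 : 0 < Q := by
    rw [hQ]
    positivity
  have h1 : 1 / (K / (2 * n)) + 4 * D ≤ (2 / K + 4) * n := by
    have h2 : 1 / (K / (2 * n)) = 2 / K * n := by field_simp
    rw [h2]
    linarith
  calc 4 * (2 * N + 1) ^ 2 * (β * s) * (η * (1 / (K / (2 * n)) + 4 * D))
      ≤ 4 * (2 * N + 1) ^ 2 * (β * s) * (η * ((2 / K + 4) * n)) := by gcongr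
    _ = 4 * (2 * N + 1) ^ 2 * β * (2 / K + 4) * s * (η * Real.sqrt n) * Real.sqrt n := by
        linear_combination (-(4 * (2 * N + 1) ^ 2 * β * (2 / K + 4) * s * η)) *
          Real.mul_self_sqrt hn.le
    _ ≤ 4 * (2 * N + 1) ^ 2 * β * (2 / K + 4) * s * (γ / (3 * Q))
          * (Real.sqrt (2 * m) * s) := by gcongr
    _ = s ^ 2 * (γ / (3 * Q) * Q) := by
        rw [hQ]
        ring
    _ = s ^ 2 * (γ / 3) := by
        field_simp

theorem mainTheorem10 (K E : ℝ) (hK : 0 < K) :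
    ∃ c : ℝ, 0 < c ∧
      ∀ δ : ℕ → ℝ, Filter.Tendsto δ Filter.atTop (nhds 0) →
        ∃ n₀ : ℕ, ∀ n : ℕ, n₀ ≤ n →
          ∀ (R : Fin n → Type u) [∀ i, MeasurableSpace (R i)] (Ω : Type v) [MeasurableSpace Ω]
            (M : Mechanism (LargeUtility n (K / n)) R Ω Bool) (ε η : ℝ),
            ε ≤ E → M.IsJointDP ε (δ n) → ComputesCoarseCorrelatedEq M η →
              c / Real.sqrt (n * Real.log n) ≤ η := by
  -- `γ` is the admissible fraction of wrong bits, against a lower bound in which `1 - δ n > 1 / 2`.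
  -- It is split equally among the grid width `β`, the regret, and the truncation at `N`.
  obtain ⟨γ, hγ, hγE⟩ : ∃ γ : ℝ, 0 < γ ∧ (1 + Real.exp E) * γ = 1 / 2 :=
    ⟨1 / (2 * (1 + Real.exp E)), by positivity, by field_simp⟩
  obtain ⟨β, hβ, hβγ⟩ : ∃ β : ℝ, 0 < β ∧ 5 * β ^ 2 = γ / 3 := by
    refine ⟨Real.sqrt (γ / 15), by positivity, ?_⟩
    rw [Real.sq_sqrt (by positivity)]
    ring
  obtain ⟨N, hN, hNγ⟩ : ∃ N : ℕ, 1 ≤ N ∧ 54 / (β ^ 2 * N ^ 2) ≤ γ / 3 := by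
    obtain ⟨N, hN⟩ := exists_nat_ge (162 / (β ^ 2 * γ))
    refine ⟨N + 1, by omega, ?_⟩
    have h0 : (0 : ℝ) ≤ N := Nat.cast_nonneg N
    rw [div_le_iff₀ (by positivity)] at hN ⊢
    push_cast
    have h1 : (0 : ℝ) ≤ β ^ 2 * γ := by positivity
    nlinarith [mul_nonneg h1 h0, mul_nonneg h1 (sq_nonneg (N : ℝ))]
  -- The second condition makes `2 ^ k` small enough relative to `n` for the query players' payoffs
  -- to stay in `[0, 1]`.
  obtain ⟨m, hmN, hmK⟩ : ∃ m : ℕ, 2 * N + 2 ≤ m ∧ K * (1 + β * N) ≤ m := by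
    obtain ⟨m, hm⟩ := exists_nat_ge (K * (1 + β * N))
    exact ⟨max m (2 * N + 2), le_max_right _ _, hm.trans (by exact_mod_cast le_max_left _ _)⟩
  have hm0 : (0 : ℝ) < m := by
    have : 0 < m := by omega
    exact_mod_cast this
  set Q : ℝ := 4 * (2 * N + 1) ^ 2 * β * (2 / K + 4) * Real.sqrt (2 * m) with hQ
  have hQ0 : 0 < Q := by positivity
  refine ⟨γ / (3 * Q), by positivity, fun δ hδ => ?_⟩
  obtain ⟨n₁, hn₁⟩ := Filter.eventually_atTop.1
    (hδ.eventually (gt_mem_nhds (by norm_num : (0 : ℝ) < 1 / 2)))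
  refine ⟨max n₁ (max m 3), fun n hn R _ Ω _ M ε η hε hDP hCE => ?_⟩
  have hδn : δ n < 1 / 2 := hn₁ n ((le_max_left _ _).trans hn)
  have hmn : m ≤ n := (le_max_left m 3).trans ((le_max_right _ _).trans hn)
  have hn3 : 3 ≤ n := (le_max_right m 3).trans ((le_max_right _ _).trans hn)
  have hn0 : (0 : ℝ) < n := by
    have : 0 < n := by omega
    exact_mod_cast this
  obtain ⟨k, r, ⟨e⟩, hk1, hk2⟩ := exists_roles hmN hmn
  have hd : (0 : ℝ) < 2 ^ k := by positivity
  have hk1' : 2 ^ k * (m : ℝ) ≤ n := by exact_mod_cast hk1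
  have hk2' : (n : ℝ) ≤ 2 * m * 2 ^ k := by exact_mod_cast hk2
  have hm1 : (1 : ℝ) ≤ m := by exact_mod_cast (by omega : 1 ≤ m)
  set s : ℝ := Real.sqrt (2 ^ k) with hs
  have hs0 : 0 < s := Real.sqrt_pos.2 hd
  have hss : s ^ 2 = 2 ^ k := Real.sq_sqrt hd.le
  have hs1 : s ≤ 2 ^ k := by
    have : (1 : ℝ) ≤ s := Real.one_le_sqrt.2 (one_le_pow₀ one_le_two)
    rw [← hss, sq]
    exact le_mul_of_one_le_right hs0.le this
  have hκ : 0 < K / (2 * n) := by positivity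
  have hΔ : 0 < β * s := by positivity
  have hbound : K / (2 * n) * (2 ^ k + β * s * N) ≤ 1 / 2 := by
    have h1 : 2 ^ k + β * s * N ≤ 2 ^ k * (1 + β * N) := by
      have : β * N * s ≤ β * N * 2 ^ k := mul_le_mul_of_nonneg_left hs1 (by positivity)
      linarith
    have h2 : K * (2 ^ k + β * s * N) ≤ n := by
      have := mul_le_mul_of_nonneg_left hmK hd.le
      have := mul_le_mul_of_nonneg_left h1 hK.le
      linarith
    rw [div_mul_eq_mul_div, div_le_iff₀ (by positivity)]
    linarith
  have hlam : 2 * (K / (2 * n)) = K / n := by field_simp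
  set τ := gameType e hκ.le hΔ.le hbound hlam with hτ
  have hP : ∀ x, IsCoarseCorrelatedEq η (gameUtility e (K / (2 * n)) (β * s) x) (M.play (τ x)) :=
    fun x => hCE (τ x)
  have hη : 0 ≤ η := nonneg_of_isCoarseCorrelatedEq (hP fun _ => true)
  have hlow := le_sum_wrong_bits_of_isJointDP hDP e (β * s) τ fun x j i hi =>
    Subtype.ext (gameUtility_flipBit e _ _ x j i hi).symm
  have hup := sum_integral_wrong_bits_le hκ hΔ hN (fun x => M.play (τ x)) hP
  set T := ∑ x, ∑ j, ∫ a, (if bitEstimate e (β * s) a j = x j then (0 : ℝ) else 1) ∂(M.play (τ x))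
  have hT0 : 0 ≤ T := Finset.sum_nonneg fun x _ => Finset.sum_nonneg fun j _ =>
    integral_nonneg fun a => by split_ifs <;> norm_num
  set Z : ℝ := (Fintype.card ((Fin k → Bool) → Bool) : ℝ)
  have hZ : 0 < Z := Nat.cast_pos.2 Fintype.card_pos
  have hexp : (1 + Real.exp ε) * T ≤ (1 + Real.exp E) * T :=
    mul_le_mul_of_nonneg_right (by linarith [Real.exp_le_exp.2 hε]) hT0
  have hlog : 1 ≤ Real.log n := by
    rw [Real.le_log_iff_exp_le hn0]
    have : (3 : ℝ) ≤ n := by exact_mod_cast hn3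
    linarith [Real.exp_one_lt_d9]
  by_contra! hlt
  have hηn : η * Real.sqrt n < γ / (3 * Q) := by
    rw [← lt_div_iff₀ (Real.sqrt_pos.2 hn0)]
    refine hlt.trans_le (div_le_div_of_nonneg_left (by positivity) (Real.sqrt_pos.2 hn0) ?_)
    exact Real.sqrt_le_sqrt (le_mul_of_one_le_right hn0.le hlog)
  have hsn : Real.sqrt n ≤ Real.sqrt (2 * m) * s := by
    rw [hs, ← Real.sqrt_mul (by positivity)]
    exact Real.sqrt_le_sqrt hk2'
  have hmid : 4 * (2 * (N : ℝ) + 1) ^ 2 * (β * s) * (η * (1 / (K / (2 * n)) + 4 * 2 ^ k))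
      ≤ 2 ^ k * (γ / 3) := by
    have h := query_error_bound hK hn0 hη hβ hs0 hγ hm0 N.cast_nonneg hQ
      ((le_mul_of_one_le_right hd.le hm1).trans hk1') hηn.le hsn
    rwa [hss] at h
  have hfst : 5 * (β * s) ^ 2 = 2 ^ k * (γ / 3) := by
    rw [mul_pow, hss]
    linear_combination (2 : ℝ) ^ k * hβγ
  have hlst : 54 * (2 ^ k) ^ 2 / ((β * s) ^ 2 * (N : ℝ) ^ 2) ≤ 2 ^ k * (γ / 3) := by
    have : 54 * (2 ^ k) ^ 2 / ((β * s) ^ 2 * (N : ℝ) ^ 2) = 2 ^ k * (54 / (β ^ 2 * N ^ 2)) := by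
      have hN0 : (N : ℝ) ≠ 0 := by positivity
      rw [mul_pow, hss]
      field_simp
    rw [this]
    exact mul_le_mul_of_nonneg_left hNγ hd.le
  have hT : T ≤ Z * (2 ^ k * γ) :=
    hup.trans (mul_le_mul_of_nonneg_left (by linarith) hZ.le)
  have hfinal : Z * 2 ^ k * (1 - δ n) ≤ Z * 2 ^ k * (1 / 2) := by
    have := mul_le_mul_of_nonneg_left hT (by positivity : 0 ≤ 1 + Real.exp E)
    have h2 : (1 + Real.exp E) * (Z * (2 ^ k * γ)) = Z * 2 ^ k * (1 / 2) := by
      rw [← hγE]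
      ring
    linarith
  have := le_of_mul_le_mul_left hfinal (by positivity)
  linarith
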